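/- Let $d\ge 1$. Embed $\mathbb R^d$ in the real projective space $\mathbb P\mathbb R^d$ by $x\mapsto(1:x_1:\dots:x_d)$; a projective map is a map of $\mathbb P\mathbb R^d$ to itself induced by an injective linear map of $\mathbb R^{d+1}$. Write $B(0,r)$ for the open Euclidean ball in $\mathbb R^d$. For a domain (nonempty connected open set) $D\subset\mathbb R^d$ and $z\in D$, let $$s_D(z)=\sup\{r>0:\ \text{there is a projective map }\Phi\text{ with }\Phi(z)=0,\ \Phi(D)\subset B(0,1),\ B(0,r)\subset\Phi(D)\},$$ with $s_D(z)=0$ if there is no such $r$. Call $D$ proper if it contains no affine line. (1) For every $d\ge1$ there is $r_d>0$ such that for every proper convex domain $D\subset\mathbb R^d$ and every $z\in D$, $s_D(z)\ge r_d$. (2) If $D\subset\mathbb R^d$ is a domain such that $\inf_{z\in D}s_D(z)>0$, then $D$ is convex and proper. In particular, with $r_d$ as in (1), for no domain $D\subset\mathbb R^d$ does $\inf_{z\in D}s_D(z)$ lie in $(0,r_d)$. -/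

import Mathlib

open scoped LinearAlgebra.Projectivization

noncomputable section

namespace ProjSqueeze

/-- Euclidean space `ℝ^d`. -/
abbrev E (d : ℕ) : Type := EuclideanSpace ℝ (Fin d)

/-- Real projective space `ℙ ℝ^d`: the lines through the origin of `ℝ × ℝ^d`, which is `ℝ^(d+1)`
with its first coordinate singled out. -/
abbrev P (d : ℕ) : Type := ℙ ℝ (ℝ × E d)

/-- The standard affine chart `ℝ^d → ℙ ℝ^d`, `x ↦ (1 : x₁ : ⋯ : x_d)`. -/
def emb {d : ℕ} (x : E d) : P d :=
  Projectivization.mk ℝ ((1 : ℝ), x) (fun h => one_ne_zero (congrArg Prod.fst h))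

/-- A projective map of `ℙ ℝ^d` is a map induced by a linear map of `ℝ^(d+1)`. (Injectivity is what
makes the induced map defined on all of `ℙ ℝ^d`.) -/
def IsProjectiveMap {d : ℕ} (Φ : P d → P d) : Prop :=
  ∃ (T : (ℝ × E d) →ₗ[ℝ] (ℝ × E d)) (hT : Function.Injective T), Φ = Projectivization.map T hT

/-- The radii `r > 0` for which some projective map `Φ` satisfies `Φ(z) = 0`, `Φ(D) ⊆ B(0,1)` and
`B(0,r) ⊆ Φ(D)`, where `ℝ^d` is regarded as a subset of `ℙ ℝ^d`. -/
def squeezingRadii {d : ℕ} (D : Set (E d)) (z : E d) : Set ℝ :=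
  {r : ℝ | 0 < r ∧ ∃ Φ : P d → P d, IsProjectiveMap Φ ∧
    Φ (emb z) = emb 0 ∧
    Φ '' (emb '' D) ⊆ emb '' Metric.ball (0 : E d) 1 ∧
    emb '' Metric.ball (0 : E d) r ⊆ Φ '' (emb '' D)}

/-- The projective squeezing function `s_D(z)`. The supremum of the empty set is `0` in `ℝ`, which
is the convention for domains not projectively equivalent to a bounded domain. -/
def squeezing {d : ℕ} (D : Set (E d)) (z : E d) : ℝ :=
  sSup (squeezingRadii D z)

/-- A domain: a nonempty connected open set. -/
def IsDomainSet {d : ℕ} (D : Set (E d)) : Prop :=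
  IsOpen D ∧ IsConnected D

/-- A set is proper if it contains no affine line. -/
def IsProper {d : ℕ} (D : Set (E d)) : Prop :=
  ¬ ∃ p v : E d, v ≠ 0 ∧ ∀ t : ℝ, p + t • v ∈ D

end ProjSqueeze

end

/-!
Both directions are arguments about linear maps `T` of `ℝ × ℝ^d` (`Normalizes`).

*Proper convex domains.* The functionals that are nonnegative on the cone over `D` and equal to `1`
at `(1, z)` form a compact convex set `dualSlice D z`, which spans the dual because `D` contains no
line. Choose `f₀, …, f_d` in it with maximal `|det|`. By Cramer's rule every `g` in the slice is a
combination of the `fᵢ` with coefficients in `[-1, 1]` and sum `1`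
(`exists_basis_mem_abs_repr_le_one`). In the coordinates `fᵢ` the domain is therefore contained in
the simplex `fᵢ ≥ 0`, of which `z` is the barycentre, and contains all points where the `fᵢ` are
almost equal, since there every `g` is positive. A fixed projective map (`simplexChart`) takes this
simplex into the unit ball, and the radius `(d + 1)⁻³` works for all `D` and `z`.

*Uniformly squeezed domains.* Suppose a segment lies in the closure of `D` and leaves `D` for the
first time at an inner point `p`. For `z ∈ D` on the segment just before `p`, the map normalizing
`D` at `z` sends the segment into the closed unit ball and `z` to `0`; it is fractional linear on
the segment, so its expansion at `z` is bounded in terms of the distance to the ends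
(`Normalizes.add_smul_mem`). Hence it sends `p` into `B(0,r)`, which is in the image of `D`, and
`p ∈ D`. So segments in the closure of `D` with endpoints in `D` stay in `D`, and connectedness
gives convexity (`convex_of_forall_normalizes`). Properness only needs one normalizing map, as no
projective map sends an affine line into a bounded set.
-/

open Submodule

namespace ProjSqueeze

/-! ### Maximal-volume bases in a compact spanning set -/

/-- A compact spanning set `K` of a finite-dimensional real space contains a basis in which every
point of `K` has coordinates of absolute value at most `1`: by Cramer's rule, any family in `K`
maximising `|det|` is such a basis. -/
lemma exists_basis_mem_abs_repr_le_one {ι V : Type*} [Fintype ι] [NormedAddCommGroup V]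
    [NormedSpace ℝ V] [FiniteDimensional ℝ V] (e : Module.Basis ι ℝ V) {K : Set V}
    (hK : IsCompact K) (hspan : span ℝ K = ⊤) :
    ∃ b : Module.Basis ι ℝ V, (∀ i, b i ∈ K) ∧ ∀ g ∈ K, ∀ i, |b.repr g i| ≤ 1 := by
  classical
  obtain ⟨s, hsK, hs, hli⟩ := exists_linearIndependent ℝ K
  have b₀ : ∃ b : Module.Basis ι ℝ V, ∀ i, b i ∈ K := by
    let b := Module.Basis.mk hli (by rw [Subtype.range_coe, hs, hspan])
    refine ⟨b.reindex (b.indexEquiv e), fun i => hsK ?_⟩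
    simp [b]
  obtain ⟨b₀, hb₀⟩ := b₀
  have hcont : Continuous fun v : ι → V => |e.det v| := by
    simp only [Module.Basis.det_apply]
    refine (Continuous.matrix_det (continuous_matrix fun i j => ?_)).abs
    exact ((e.coord i).continuous_of_finiteDimensional).comp (continuous_apply j)
  obtain ⟨v, hvK, hmax⟩ := (isCompact_univ_pi fun _ : ι => hK).exists_isMaxOn
    ⟨b₀, fun i _ => hb₀ i⟩ hcont.continuousOn
  have hpos : 0 < |e.det v| :=
    (abs_pos.2 (e.isUnit_det b₀).ne_zero).trans_le (hmax fun i _ => hb₀ i)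
  obtain ⟨hvli, hvsp⟩ := e.is_basis_iff_det.2 (isUnit_iff_ne_zero.2 (abs_pos.1 hpos))
  refine ⟨Module.Basis.mk hvli hvsp.ge, fun i => by simpa using hvK i trivial,
    fun g hg i => ?_⟩
  have hcramer := congrArg (fun f => f g) (e.det_smul_mk_coord_eq_det_update hvli hvsp.ge i)
  have hle : |e.det (Function.update v i g)| ≤ |e.det v| := by
    refine hmax fun j _ => ?_
    by_cases hj : j = i
    · subst hj; simpa using hg
    · simpa [hj] using hvK j trivial
  have hmul : e.det v * (Module.Basis.mk hvli hvsp.ge).repr g i =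
      e.det (Function.update v i g) := by simpa using hcramer
  rw [← hmul, abs_mul] at hle
  exact le_of_mul_le_mul_left (by simpa using hle) hpos

/-! ### Squeezing radii in homogeneous coordinates -/

variable {d : ℕ}

/-- The linear map `T` of `ℝ × ℝ^d` induces a projective map that sends `z` to `0`, maps `D` into
the unit ball and has `B(0,r)` in the image of `D`. The point `T (1, x)` has affine image `w` iff
its second component is `w` times its first. -/
structure Normalizes (T : (ℝ × E d) →ₗ[ℝ] (ℝ × E d)) (D : Set (E d)) (z : E d) (r : ℝ) : Prop where
  injective : Function.Injective T
  center : (T (1, z)).2 = 0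
  norm_lt : ∀ x ∈ D, ‖(T (1, x)).2‖ < |(T (1, x)).1|
  ball_subset : ∀ w : E d, ‖w‖ < r → ∃ x ∈ D, (T (1, x)).2 = (T (1, x)).1 • w

lemma map_emb_eq_emb_iff {T : (ℝ × E d) →ₗ[ℝ] (ℝ × E d)} (hT : Function.Injective T) (x w : E d) :
    Projectivization.map T hT (emb x) = emb w ↔ (T (1, x)).2 = (T (1, x)).1 • w := by
  rw [emb, emb, Projectivization.map_mk, Projectivization.mk_eq_mk_iff']
  constructor
  · rintro ⟨a, ha⟩
    simp [← ha]
  · intro h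
    exact ⟨(T (1, x)).1, Prod.ext (by simp) h.symm⟩

lemma one_prod_ne_zero (x : E d) : ((1 : ℝ), x) ≠ 0 := fun h => one_ne_zero (congrArg Prod.fst h)

lemma mem_squeezingRadii_iff {D : Set (E d)} {z : E d} {r : ℝ} :
    r ∈ squeezingRadii D z ↔ 0 < r ∧ ∃ T, Normalizes T D z r := by
  refine and_congr_right fun _ => ⟨?_, ?_⟩
  · rintro ⟨_, ⟨T, hT, rfl⟩, hz, hD, hr⟩
    refine ⟨T, hT, by simpa using (map_emb_eq_emb_iff hT z 0).1 hz, fun x hx => ?_, fun w hw => ?_⟩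
    · obtain ⟨w, hw, hxw⟩ := hD ⟨_, ⟨x, hx, rfl⟩, rfl⟩
      have h := (map_emb_eq_emb_iff hT x w).1 hxw.symm
      have hne : (T (1, x)).1 ≠ 0 := fun h0 => one_prod_ne_zero x <|
        hT <| (Prod.ext h0 (by simp [h, h0]) : T (1, x) = 0).trans T.map_zero.symm
      rw [h, norm_smul, Real.norm_eq_abs]
      exact mul_lt_of_lt_one_right (abs_pos.2 hne) (by simpa using hw)
    · obtain ⟨_, ⟨x, hx, rfl⟩, hxw⟩ := hr ⟨w, by simpa using hw, rfl⟩
      exact ⟨x, hx, (map_emb_eq_emb_iff hT x w).1 hxw⟩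
  · rintro ⟨T, h⟩
    refine ⟨_, ⟨T, h.injective, rfl⟩, ?_, ?_, ?_⟩
    · rw [map_emb_eq_emb_iff, h.center, smul_zero]
    · rintro _ ⟨_, ⟨x, hx, rfl⟩, rfl⟩
      have hlt := h.norm_lt x hx
      have hpos : 0 < |(T (1, x)).1| := (norm_nonneg _).trans_lt hlt
      refine ⟨(T (1, x)).1⁻¹ • (T (1, x)).2, ?_, ((map_emb_eq_emb_iff h.injective _ _).2 ?_).symm⟩
      · rw [mem_ball_zero_iff, norm_smul, norm_inv, Real.norm_eq_abs, inv_mul_lt_iff₀ hpos, mul_one]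
        exact hlt
      · rw [smul_inv_smul₀ (abs_pos.1 hpos)]
    · rintro _ ⟨w, hw, rfl⟩
      obtain ⟨x, hx, hxw⟩ := h.ball_subset w (by simpa using hw)
      exact ⟨_, ⟨x, hx, rfl⟩, (map_emb_eq_emb_iff h.injective _ _).2 hxw⟩

/-- In positive dimension the squeezing radii are bounded by `1`, so that the supremum defining
`squeezing` is not a junk value. -/
lemma bddAbove_squeezingRadii (hd : 1 ≤ d) (D : Set (E d)) (z : E d) :
    BddAbove (squeezingRadii D z) := by
  refine ⟨1, fun r hr => ?_⟩
  obtain ⟨-, T, hT⟩ := mem_squeezingRadii_iff.1 hr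
  by_contra! h1
  let w : E d := EuclideanSpace.single ⟨0, hd⟩ 1
  have hw : ‖w‖ = 1 := by simp [w]
  obtain ⟨x, hx, hxw⟩ := hT.ball_subset w (hw ▸ h1)
  have := hT.norm_lt x hx
  rw [hxw, norm_smul, hw, mul_one, Real.norm_eq_abs] at this
  exact this.false

lemma squeezing_nonneg (D : Set (E d)) (z : E d) : 0 ≤ squeezing D z :=
  Real.sSup_nonneg fun _ hr => hr.1.le

lemma Normalizes.mono {T : (ℝ × E d) →ₗ[ℝ] (ℝ × E d)} {D : Set (E d)} {z : E d} {r s : ℝ}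
    (h : Normalizes T D z r) (hs : s ≤ r) : Normalizes T D z s :=
  ⟨h.injective, h.center, h.norm_lt, fun w hw => h.ball_subset w (hw.trans_le hs)⟩

lemma exists_normalizes_of_lt_squeezing {D : Set (E d)} {z : E d} {s : ℝ} (hs : 0 ≤ s)
    (h : s < squeezing D z) : ∃ T, Normalizes T D z s := by
  have hne : (squeezingRadii D z).Nonempty := by
    by_contra hne
    rw [squeezing, Set.not_nonempty_iff_eq_empty.1 hne, Real.sSup_empty] at h
    exact absurd h hs.not_gt
  obtain ⟨r, hr, hsr⟩ := exists_lt_of_lt_csSup hne h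
  obtain ⟨-, T, hT⟩ := mem_squeezingRadii_iff.1 hr
  exact ⟨T, hT.mono hsr.le⟩

/-! ### Proper convex domains are uniformly squeezed -/

/-- The slice, by the hyperplane of functionals taking the value `1` at `(1, z)`, of the dual of
the cone spanned by `{1} × D`. -/
def dualSlice (D : Set (E d)) (z : E d) : Set ((ℝ × E d) →L[ℝ] ℝ) :=
  {g | g (1, z) = 1 ∧ ∀ x ∈ D, 0 ≤ g (1, x)}

lemma fst_mem_dualSlice (D : Set (E d)) (z : E d) :
    ContinuousLinearMap.fst ℝ ℝ (E d) ∈ dualSlice D z := by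
  simp [dualSlice]

lemma isCompact_dualSlice {D : Set (E d)} (hD : IsOpen D) {z : E d} (hz : z ∈ D) :
    IsCompact (dualSlice D z) := by
  refine Metric.isCompact_of_isClosed_isBounded ?_ ?_
  · refine IsClosed.and (isClosed_eq (by fun_prop) continuous_const) ?_
    simp only [Set.ofPred_forall]
    exact isClosed_iInter fun x => isClosed_iInter fun _ =>
      isClosed_le continuous_const (by fun_prop)
  · obtain ⟨ε, hε, hball⟩ := Metric.nhds_basis_closedBall.mem_iff.1 (hD.mem_nhds hz)
    -- positivity at `z ± u` and `g (1, z) = 1` bound `g` on `{0} × closedBall 0 ε` by `1`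
    refine isBounded_iff_forall_norm_le.2 ⟨1 + (1 + ‖z‖) / ε, fun g hg => ?_⟩
    refine g.opNorm_le_bound (by positivity) fun ⟨t, x⟩ => ?_
    have hsmall : ∀ u : E d, ‖u‖ ≤ ε → g (0, u) ≤ 1 := fun u hu => by
      have h := hg.2 (z - u) (hball (by simpa [dist_eq_norm] using hu))
      have he : ((1 : ℝ), z - u) = (1, z) - (0, u) := by ext <;> simp
      rw [he, map_sub, hg.1] at h
      linarith
    have hbig : ∀ u : E d, g (0, u) ≤ ‖u‖ / ε := fun u => by
      rcases eq_or_ne u 0 with rfl | hu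
      · have : g (0, (0 : E d)) = 0 := g.map_zero
        simp [this]
      have hu' : 0 < ‖u‖ := norm_pos_iff.2 hu
      have h := hsmall ((ε / ‖u‖) • u)
        (by rw [norm_smul, Real.norm_of_nonneg (by positivity), div_mul_cancel₀ _ hu'.ne'])
      have he : ((0 : ℝ), (ε / ‖u‖) • u) = (ε / ‖u‖) • ((0 : ℝ), u) := by ext <;> simp
      rw [he, map_smul, smul_eq_mul, div_mul_eq_mul_div, div_le_one hu'] at h
      rw [le_div_iff₀ hε]
      linarith
    have habs : ∀ u : E d, |g (0, u)| ≤ ‖u‖ / ε := fun u => by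
      refine abs_le'.2 ⟨hbig u, ?_⟩
      have he : ((0 : ℝ), -u) = -((0 : ℝ), u) := by ext <;> simp
      have h := hbig (-u)
      rwa [he, map_neg, norm_neg] at h
    have he : ((t, x) : ℝ × E d) = t • (1, z) + (0, x - t • z) := by ext <;> simp
    have ht : |t| ≤ ‖(t, x)‖ := norm_fst_le (t, x)
    have hx : ‖x‖ ≤ ‖(t, x)‖ := norm_snd_le (t, x)
    have hxt : ‖x - t • z‖ ≤ (1 + ‖z‖) * ‖(t, x)‖ := by
      refine (norm_sub_le _ _).trans ?_
      rw [norm_smul, Real.norm_eq_abs]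
      nlinarith [norm_nonneg z]
    calc ‖g (t, x)‖ = |t + g (0, x - t • z)| := by
          rw [he, map_add, map_smul, hg.1, smul_eq_mul, mul_one, Real.norm_eq_abs]
      _ ≤ |t| + |g (0, x - t • z)| := abs_add_le _ _
      _ ≤ ‖(t, x)‖ + (1 + ‖z‖) * ‖(t, x)‖ / ε :=
          add_le_add ht ((habs _).trans (div_le_div_of_nonneg_right hxt hε.le))
      _ = (1 + (1 + ‖z‖) / ε) * ‖(t, x)‖ := by ring

lemma exists_mem_dualSlice_apply_eq_zero {D : Set (E d)} (hD : IsOpen D) (hc : Convex ℝ D)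
    {z x : E d} (hz : z ∈ D) (hx : x ∉ D) : ∃ g ∈ dualSlice D z, g (1, x) = 0 := by
  obtain ⟨u, hu⟩ := geometric_hahn_banach_open_point hc hD hx
  have hpos : 0 < u x - u z := sub_pos.2 (hu z hz)
  refine ⟨(u x - u z)⁻¹ • (u x • ContinuousLinearMap.fst ℝ ℝ (E d) -
    u.comp (ContinuousLinearMap.snd ℝ ℝ (E d))), ⟨?_, fun y hy => ?_⟩, ?_⟩
  · simp [hpos.ne']
  · have := hu y hy
    simp only [smul_apply, sub_apply, ContinuousLinearMap.coe_fst', ContinuousLinearMap.comp_apply,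
      ContinuousLinearMap.coe_snd', smul_eq_mul, mul_one]
    exact mul_nonneg (inv_nonneg.2 hpos.le) (by linarith)
  · simp

lemma span_dualSlice {D : Set (E d)} (hD : IsOpen D) (hc : Convex ℝ D) (hp : IsProper D)
    {z : E d} (hz : z ∈ D) : span ℝ (dualSlice D z) = ⊤ := by
  by_contra hne
  obtain ⟨F, hF0, hF⟩ := Submodule.exists_le_ker_of_lt_top _ (lt_top_iff_ne_top.2 hne)
  -- by reflexivity, `F` is evaluation at a nonzero vector `v`, annihilated by the dual slice
  let c : Module.Dual ℝ (ℝ × E d) ≃ₗ[ℝ] ((ℝ × E d) →L[ℝ] ℝ) := LinearMap.toContinuousLinearMap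
  let v : ℝ × E d := (Module.evalEquiv ℝ (ℝ × E d)).symm (F ∘ₗ c.toLinearMap)
  have hv : ∀ g : (ℝ × E d) →L[ℝ] ℝ, F g = g v := fun g => by
    have h : Module.evalEquiv ℝ (ℝ × E d) v = F ∘ₗ c.toLinearMap := LinearEquiv.apply_symm_apply _ _
    have h' := congrArg (fun f => f (c.symm g)) h
    have hcg : c (c.symm g) = g := c.apply_symm_apply g
    simp only [Module.evalEquiv_apply, LinearMap.comp_apply, LinearEquiv.coe_coe, hcg] at h'
    exact h'.symm
  have hann : ∀ g ∈ dualSlice D z, g v = 0 := fun g hg => by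
    rw [← hv]; exact hF (subset_span hg)
  have hv1 : v.1 = 0 := hann _ (fst_mem_dualSlice D z)
  have hv2 : v.2 ≠ 0 := fun h2 => hF0 <| LinearMap.ext fun g => by
    rw [hv, show v = 0 from Prod.ext hv1 h2, map_zero, LinearMap.zero_apply]
  refine hp ⟨z, v.2, hv2, fun t => ?_⟩
  by_contra hmem
  obtain ⟨g, hg, hg0⟩ := exists_mem_dualSlice_apply_eq_zero hD hc hz hmem
  have he : ((1 : ℝ), z + t • v.2) = (1, z) + t • v := by ext <;> simp [hv1]
  rw [he, map_add, map_smul, hann g hg, hg.1] at hg0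
  simp at hg0

/-- The linear map with homogeneous coordinates `∑ᵢ fᵢ` and `(d + 1)⁻¹ (fⱼ₊₁ - f₀)`, which sends the
simplex where all `fᵢ` are nonnegative into the unit ball and the point where they all agree
to `0`. -/
noncomputable def simplexChart (f : Fin (d + 1) → (ℝ × E d) →L[ℝ] ℝ) : (ℝ × E d) →ₗ[ℝ] (ℝ × E d) :=
  LinearMap.prod (∑ i, (f i).toLinearMap)
    ((WithLp.linearEquiv 2 ℝ (Fin d → ℝ)).symm.toLinearMap ∘ₗ
      LinearMap.pi fun j => ((d : ℝ) + 1)⁻¹ • ((f j.succ).toLinearMap - (f 0).toLinearMap))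

lemma simplexChart_fst (f : Fin (d + 1) → (ℝ × E d) →L[ℝ] ℝ) (v : ℝ × E d) :
    (simplexChart f v).1 = ∑ i, f i v := by
  simp [simplexChart]

lemma simplexChart_snd (f : Fin (d + 1) → (ℝ × E d) →L[ℝ] ℝ) (v : ℝ × E d) (j : Fin d) :
    (simplexChart f v).2 j = ((d : ℝ) + 1)⁻¹ * (f j.succ v - f 0 v) := by
  simp [simplexChart]

lemma simplexChart_injective (f : Module.Basis (Fin (d + 1)) ℝ ((ℝ × E d) →L[ℝ] ℝ)) :
    Function.Injective (simplexChart f) := by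
  refine (injective_iff_map_eq_zero _).2 fun v hv => ?_
  have hdiff : ∀ i, f i v = f 0 v := Fin.cases rfl fun j => by
    have h := simplexChart_snd f v j
    rw [hv] at h
    have hd' : ((d : ℝ) + 1)⁻¹ ≠ 0 := by positivity
    exact sub_eq_zero.1 ((mul_eq_zero.1 h.symm).resolve_left hd')
  have hsum := simplexChart_fst f v
  rw [hv, Finset.sum_congr rfl fun i _ => hdiff i] at hsum
  have h0 : f 0 v = 0 := by
    have : (d : ℝ) + 1 ≠ 0 := by positivity
    simpa [this] using hsum.symm
  have hall : ∀ g : (ℝ × E d) →L[ℝ] ℝ, g v = 0 := fun g => by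
    rw [← f.sum_repr g, sum_apply]
    exact Finset.sum_eq_zero fun i _ => by rw [smul_apply, hdiff, h0, smul_zero]
  by_contra hne
  obtain ⟨g, hg⟩ := SeparatingDual.exists_ne_zero (R := ℝ) hne
  exact hg (hall g)

lemma norm_simplexChart_snd_lt {f : Fin (d + 1) → (ℝ × E d) →L[ℝ] ℝ} {v : ℝ × E d}
    (hf : ∀ i, 0 ≤ f i v) (hne : simplexChart f v ≠ 0) :
    ‖(simplexChart f v).2‖ < |(simplexChart f v).1| := by
  have hle : ∀ i, f i v ≤ ∑ i, f i v := fun i =>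
    Finset.single_le_sum (fun j _ => hf j) (Finset.mem_univ i)
  have hs : 0 ≤ ∑ i, f i v := Finset.sum_nonneg fun i _ => hf i
  have hd' : (0 : ℝ) < (d : ℝ) + 1 := by positivity
  have hsq : ‖(simplexChart f v).2‖ ^ 2 ≤
      d * (((d : ℝ) + 1)⁻¹ * ∑ i, f i v) ^ 2 := by
    rw [EuclideanSpace.real_norm_sq_eq]
    refine (Finset.sum_le_card_nsmul _ _ ((((d : ℝ) + 1)⁻¹ * ∑ i, f i v) ^ 2)
      fun j _ => ?_).trans (by simp)
    rw [simplexChart_snd, mul_pow, mul_pow]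
    refine mul_le_mul_of_nonneg_left (sq_le_sq.2 ?_) (by positivity)
    rw [abs_of_nonneg hs]
    exact abs_sub_le_iff.2 ⟨by linarith [hle j.succ, hf 0], by linarith [hle 0, hf j.succ]⟩
  have hs' : 0 < ∑ i, f i v := by
    refine hs.lt_of_ne fun h0 => hne ?_
    rw [← h0] at hsq
    exact Prod.ext (by simpa [simplexChart_fst] using h0.symm) (by simpa using hsq)
  rw [simplexChart_fst, abs_of_nonneg hs]
  refine lt_of_pow_lt_pow_left₀ 2 hs (hsq.trans_lt ?_)
  rw [mul_pow, ← mul_assoc, inv_pow]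
  refine mul_lt_of_lt_one_left (by positivity) ?_
  rw [← div_eq_mul_inv, div_lt_one (by positivity)]
  nlinarith [(Nat.cast_nonneg d : (0 : ℝ) ≤ d)]

/-- If the image of `v` under `simplexChart` lies close to that of `(1, z)`, then `v` lies in every
half-space of the dual slice: the values `fᵢ v` nearly agree, and `g` is a combination of the `fᵢ`
with bounded coefficients of sum `1`. -/
lemma pos_of_simplexChart_eq (f : Module.Basis (Fin (d + 1)) ℝ ((ℝ × E d) →L[ℝ] ℝ))
    {z : E d} (hf : ∀ i, f i (1, z) = 1) {g : (ℝ × E d) →L[ℝ] ℝ} (hg : g (1, z) = 1)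
    (hrepr : ∀ i, |f.repr g i| ≤ 1) {v : ℝ × E d} {w : E d} (hw : ‖w‖ < (((d : ℝ) + 1) ^ 3)⁻¹)
    (hv : simplexChart f v = (1, w)) : 0 < g v := by
  have hd' : (0 : ℝ) < (d : ℝ) + 1 := by positivity
  have hgv : ∀ u, g u = ∑ i, f.repr g i * f i u := fun u => by
    conv_lhs => rw [← f.sum_repr g, sum_apply]
    rfl
  have hsum : ∑ i, f i v = 1 := by rw [← simplexChart_fst, hv]
  have hcoef : ∑ i, f.repr g i = 1 := by rw [← hg, hgv]; simp [hf]
  have hdiff : ∀ j : Fin d, |f j.succ v - f 0 v| ≤ (((d : ℝ) + 1) ^ 2)⁻¹ := fun j => by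
    have h := simplexChart_snd f v j
    rw [hv] at h
    have h' : f j.succ v - f 0 v = ((d : ℝ) + 1) * w j := by
      rw [show w j = _ from h]; field_simp
    rw [h', abs_mul, abs_of_pos hd']
    calc ((d : ℝ) + 1) * |w j| ≤ ((d : ℝ) + 1) * (((d : ℝ) + 1) ^ 3)⁻¹ :=
          mul_le_mul_of_nonneg_left ((PiLp.norm_apply_le w j).trans hw.le) hd'.le
      _ = _ := by field_simp
  rw [Fin.sum_univ_succ] at hsum hcoef
  rw [hgv, Fin.sum_univ_succ]
  set ρ : ℝ := (((d : ℝ) + 1) ^ 2)⁻¹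
  have hρ1 : ρ * ((d : ℝ) + 1) ^ 2 = 1 := inv_mul_cancel₀ (by positivity)
  have hρ0 : 0 < ρ := by positivity
  have h1 : ∑ j : Fin d, (f j.succ v - f 0 v) ≤ d * ρ := by
    refine (Finset.sum_le_card_nsmul _ _ ρ fun j _ => (le_abs_self _).trans (hdiff j)).trans
      (by simp)
  have h2 : -(d * ρ) ≤ ∑ j : Fin d, f.repr g j.succ * (f j.succ v - f 0 v) := by
    refine (abs_le.1 ((Finset.abs_sum_le_sum_abs _ _).trans
      ((Finset.sum_le_card_nsmul _ _ ρ fun j _ => ?_).trans (by simp)))).1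
    rw [abs_mul]
    exact (mul_le_of_le_one_left (abs_nonneg _) (hrepr _)).trans (hdiff j)
  rw [Finset.sum_sub_distrib] at h1
  simp only [mul_sub, Finset.sum_sub_distrib, ← Finset.sum_mul] at h2
  simp only [Finset.sum_const, Finset.card_univ, Fintype.card_fin, nsmul_eq_mul] at h1
  -- `(d + 1) g v ≥ 1 - dρ - (d + 1)dρ > 0`, as `ρ (d + 1)² = 1`
  have h3 : f.repr g 0 * f 0 v + ∑ j : Fin d, f.repr g j.succ * f j.succ v ≥ f 0 v - d * ρ := by
    have : f.repr g 0 = 1 - ∑ j : Fin d, f.repr g j.succ := by linarith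
    rw [this]
    linarith
  have h4 : ((d : ℝ) + 1) * f 0 v ≥ 1 - d * ρ := by linarith
  have h5 : 0 < ((d : ℝ) + 1) * (f 0 v - d * ρ) := by nlinarith
  linarith [pos_of_mul_pos_right h5 hd'.le]

lemma exists_normalizes_of_convex {D : Set (E d)} (hD : IsOpen D) (hc : Convex ℝ D)
    (hp : IsProper D) {z : E d} (hz : z ∈ D) :
    ∃ T, Normalizes T D z (((d : ℝ) + 1) ^ 3)⁻¹ := by
  have hrank : Module.finrank ℝ ((ℝ × E d) →L[ℝ] ℝ) = d + 1 := by
    rw [← (LinearMap.toContinuousLinearMap : Module.Dual ℝ (ℝ × E d) ≃ₗ[ℝ] _).finrank_eq,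
      Subspace.dual_finrank_eq]
    simp [add_comm]
  obtain ⟨f, hfK, hrepr⟩ := exists_basis_mem_abs_repr_le_one
    (Module.finBasisOfFinrankEq ℝ _ hrank) (isCompact_dualSlice hD hz) (span_dualSlice hD hc hp hz)
  have hinj := simplexChart_injective f
  refine ⟨simplexChart f, hinj, ?_, fun x hx => ?_, fun w hw => ?_⟩
  · ext j
    rw [simplexChart_snd, (hfK _).1, (hfK _).1]
    simp
  · exact norm_simplexChart_snd_lt (fun i => (hfK i).2 x hx) fun h =>
      one_prod_ne_zero x (hinj (h.trans (map_zero _).symm))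
  · obtain ⟨v, hv⟩ := LinearMap.surjective_of_injective hinj (1, w)
    have hpos : ∀ g ∈ dualSlice D z, 0 < g v := fun g hg =>
      pos_of_simplexChart_eq f (fun i => (hfK i).1) hg.1 (hrepr g hg) hw hv
    have hv1 : 0 < v.1 := hpos _ (fst_mem_dualSlice D z)
    have hvx : ((1 : ℝ), v.1⁻¹ • v.2) = v.1⁻¹ • v := by ext <;> simp [hv1.ne']
    refine ⟨v.1⁻¹ • v.2, ?_, by rw [hvx, map_smul, hv]; simp⟩
    by_contra hmem
    obtain ⟨g, hg, hg0⟩ := exists_mem_dualSlice_apply_eq_zero hD hc hz hmem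
    rw [hvx, map_smul, smul_eq_mul] at hg0
    exact (mul_pos (inv_pos.2 hv1) (hpos g hg)).ne' hg0

/-! ### Uniformly squeezed domains are convex and proper -/

lemma apply_one_add_smul (T : (ℝ × E d) →ₗ[ℝ] (ℝ × E d)) (z v : E d) (t : ℝ) :
    T (1, z + t • v) = T (1, z) + t • T (0, v) := by
  rw [← map_smul, ← map_add]
  congr 1
  ext <;> simp

/-- A line in `D` would be sent by `T` to a line in the unit ball, up to scaling. -/
lemma Normalizes.isProper {T : (ℝ × E d) →ₗ[ℝ] (ℝ × E d)} {D : Set (E d)} {z : E d} {r : ℝ}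
    (h : Normalizes T D z r) : IsProper D := by
  rintro ⟨p, v, hv, hline⟩
  have hlt : ∀ t : ℝ, ‖(T (1, p)).2 + t • (T (0, v)).2‖ < |(T (1, p)).1 + t * (T (0, v)).1| :=
    fun t => by simpa [apply_one_add_smul] using h.norm_lt _ (hline t)
  have hβ : (T (0, v)).1 = 0 := by
    by_contra hβ
    have := hlt (-(T (1, p)).1 / (T (0, v)).1)
    rw [div_mul_cancel₀ _ hβ, add_neg_cancel, abs_zero] at this
    exact absurd this (norm_nonneg _).not_gt
  have hB : (T (0, v)).2 ≠ 0 := fun hB => hv <| congrArg Prod.snd <|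
    h.injective <| (Prod.ext hβ hB : T (0, v) = 0).trans T.map_zero.symm
  have hB' : 0 < ‖(T (0, v)).2‖ := norm_pos_iff.2 hB
  set M := |(T (1, p)).1| + ‖(T (1, p)).2‖
  have h1 := hlt (M / ‖(T (0, v)).2‖)
  have h2 : ‖(M / ‖(T (0, v)).2‖) • (T (0, v)).2‖ = M := by
    rw [norm_smul, Real.norm_of_nonneg (by positivity), div_mul_cancel₀ _ hB'.ne']
  have h3 := norm_sub_le_norm_add ((M / ‖(T (0, v)).2‖) • (T (0, v)).2) (T (1, p)).2
  rw [h2, add_comm ((M / ‖(T (0, v)).2‖) • (T (0, v)).2)] at h3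
  rw [hβ, mul_zero, add_zero] at h1
  linarith

/-- A one-dimensional Schwarz lemma: on a segment in `closure D` centred at `z` the map induced by
`T` is expanding by a controlled factor only, so that points of the segment close to `z` are sent
into `B(0,r)`, hence belong to `D`. -/
lemma Normalizes.add_smul_mem {T : (ℝ × E d) →ₗ[ℝ] (ℝ × E d)} {D : Set (E d)} {z : E d} {r : ℝ}
    (h : Normalizes T D z r) {v : E d} {c δ : ℝ} (hc : 0 < c) (hδ : 0 ≤ δ) (hr : 0 < r)
    (hseg : ∀ t ∈ Set.Icc (-c) c, z + t • v ∈ closure D) (hδr : δ * (2 + r) < r * c) :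
    z + δ • v ∈ D := by
  have hne : ∀ x, T (1, x) ≠ 0 := fun x h0 =>
    one_prod_ne_zero x (h.injective (h0.trans T.map_zero.symm))
  have hTc : Continuous T := T.continuous_of_finiteDimensional
  have hcl : ∀ x ∈ closure D, ‖(T (1, x)).2‖ ≤ |(T (1, x)).1| := by
    have hclosed : IsClosed {x : E d | ‖(T (1, x)).2‖ ≤ |(T (1, x)).1|} :=
      isClosed_le (by fun_prop) (by fun_prop)
    exact closure_minimal (fun x hx => (h.norm_lt x hx).le) hclosed
  have hz : ∀ t : ℝ, T (1, z + t • v) =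
      ((T (1, z)).1 + t * (T (0, v)).1, t • (T (0, v)).2) := fun t => by
    rw [apply_one_add_smul]
    ext <;> simp [h.center]
  set α := (T (1, z)).1
  set β := (T (0, v)).1
  set B := (T (0, v)).2
  have hα : 0 < |α| := abs_pos.2 fun h0 => hne z (Prod.ext h0 h.center)
  have hle : ∀ t ∈ Set.Icc (-c) c, |t| * ‖B‖ ≤ |α + t * β| := fun t ht => by
    have := hcl _ (hseg t ht)
    rwa [hz, norm_smul, Real.norm_eq_abs] at this
  -- otherwise the denominator `α + t β` vanishes at an inner point of the segment
  have hβ : c * |β| ≤ |α| := by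
    by_contra! hlt
    have hβ0 : 0 < |β| := pos_of_mul_pos_right (hα.trans hlt) hc.le
    have ht : |(-α / β)| ≤ c := by
      rw [abs_div, abs_neg, div_le_iff₀ hβ0]; exact hlt.le
    have h0 : α + -α / β * β = 0 := by rw [div_mul_cancel₀ _ (abs_pos.1 hβ0), add_neg_cancel]
    have hz' := hle _ (abs_le.1 ht)
    rw [h0, abs_zero, ← Real.norm_eq_abs, ← norm_smul] at hz'
    exact hne (z + (-α / β) • v) (by rw [hz, h0, norm_le_zero_iff.1 hz']; rfl)
  have hB : c * ‖B‖ ≤ 2 * |α| := by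
    have h1 := hle c ⟨by linarith, le_rfl⟩
    have h2 := abs_add_le α (c * β)
    rw [abs_mul, abs_of_pos hc] at h2
    rw [abs_of_pos hc] at h1
    linarith
  have hden : c * |α| - δ * |α| ≤ c * |α + δ * β| := by
    have h1 := abs_sub_abs_le_abs_sub α (-(δ * β))
    rw [abs_neg, abs_mul, abs_of_nonneg hδ, sub_neg_eq_add] at h1
    nlinarith [mul_le_mul_of_nonneg_left hβ hδ]
  have hlt : δ * ‖B‖ < |α + δ * β| * r := by
    have h1 : c * (δ * ‖B‖) < c * (|α + δ * β| * r) := by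
      nlinarith [mul_le_mul_of_nonneg_left hB hδ, mul_lt_mul_of_pos_right hδr hα,
        mul_le_mul_of_nonneg_right hden hr.le]
    exact lt_of_mul_lt_mul_left h1 hc.le
  have hden0 : 0 < |α + δ * β| :=
    pos_of_mul_pos_left ((by positivity : (0 : ℝ) ≤ δ * ‖B‖).trans_lt hlt) hr.le
  obtain ⟨x, hx, hxw⟩ := h.ball_subset ((α + δ * β)⁻¹ • δ • B) (by
    rw [norm_smul, norm_smul, norm_inv, Real.norm_eq_abs, Real.norm_of_nonneg hδ,
      inv_mul_lt_iff₀ hden0]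
    exact hlt)
  have hprop : T (((T (1, x)).1 * (α + δ * β)⁻¹) • (1, z + δ • v)) = T (1, x) := by
    rw [map_smul, hz]
    refine Prod.ext ?_ ?_
    · simp [abs_pos.1 hden0]
    · rw [hxw, Prod.smul_snd, mul_smul]
  have heq := h.injective hprop
  have h1 : (T (1, x)).1 * (α + δ * β)⁻¹ = 1 := by simpa using congrArg Prod.fst heq
  rw [h1, one_smul] at heq
  rwa [show z + δ • v = x from congrArg Prod.snd heq]

/-- If all points of an open set `D` share a squeezing radius, a segment in `closure D` with
endpoints in `D` lies in `D`: points of the segment just before its first exit from `D` are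
arbitrarily close to the exit point but at a fixed distance from the ends. -/
lemma add_smul_sub_mem_of_mem_closure {D : Set (E d)} (hD : IsOpen D) {r : ℝ} (hr : 0 < r)
    (hT : ∀ z ∈ D, ∃ T, Normalizes T D z r) {x y : E d} (hx : x ∈ D) (hy : y ∈ D)
    (hseg : ∀ t ∈ Set.Icc (0 : ℝ) 1, x + t • (y - x) ∈ closure D) :
    ∀ t ∈ Set.Icc (0 : ℝ) 1, x + t • (y - x) ∈ D := by
  by_contra! hex
  set S : Set ℝ := {t | t ∈ Set.Icc (0 : ℝ) 1 ∧ x + t • (y - x) ∉ D}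
  have hSc : IsClosed S :=
    isClosed_Icc.inter (hD.isClosed_compl.preimage (by fun_prop : Continuous fun t : ℝ =>
      x + t • (y - x)))
  have hSb : BddBelow S := ⟨0, fun t ht => ht.1.1⟩
  have hmem : sInf S ∈ S := hSc.csInf_mem hex hSb
  set τ := sInf S
  have h0 : 0 < τ := hmem.1.1.lt_of_ne fun h => hmem.2 (by rw [← h]; simpa using hx)
  have h1 : τ < 1 := hmem.1.2.lt_of_ne fun h => hmem.2 (by rw [h]; simpa using hy)
  set c := min τ (1 - τ) / 2 with hc
  have hmin : 0 < min τ (1 - τ) := lt_min h0 (by linarith)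
  have hc0 : 0 < c := half_pos hmin
  have hcτ : 2 * c ≤ τ := by linarith [min_le_left τ (1 - τ)]
  have hcτ' : 2 * c ≤ 1 - τ := by linarith [min_le_right τ (1 - τ)]
  set δ := r * c / (3 + r) with hδ
  have hδ0 : 0 < δ := by positivity
  have hδr : δ * (2 + r) < r * c := by
    rw [hδ, div_mul_eq_mul_div, div_lt_iff₀ (by positivity)]
    nlinarith [mul_pos hr hc0]
  have hδc : δ < c := by nlinarith
  have hz : x + (τ - δ) • (y - x) ∈ D := by
    by_contra hz
    have : τ ≤ τ - δ := csInf_le hSb ⟨⟨by linarith, by linarith⟩, hz⟩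
    linarith
  obtain ⟨T, hTz⟩ := hT _ hz
  refine hmem.2 ?_
  have key := hTz.add_smul_mem (v := y - x) hc0 hδ0.le hr (fun t ht => ?_) hδr
  · rwa [add_assoc, ← add_smul, sub_add_cancel] at key
  · rw [add_assoc, ← add_smul]
    exact hseg _ ⟨by linarith [ht.1], by linarith [ht.2]⟩

lemma convex_of_forall_normalizes {D : Set (E d)} (hD : IsDomainSet D) {r : ℝ} (hr : 0 < r)
    (hT : ∀ z ∈ D, ∃ T, Normalizes T D z r) : Convex ℝ D := by
  -- for fixed `x`, the set of `y` with `[x, y] ⊆ D` is open, and relatively closed in `D`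
  suffices h : ∀ x ∈ D, ∀ y ∈ D, ∀ t ∈ Set.Icc (0 : ℝ) 1, x + t • (y - x) ∈ D by
    refine convex_iff_segment_subset.2 fun x hx y hy => ?_
    rw [segment_eq_image']
    rintro _ ⟨t, ht, rfl⟩
    exact h x hx y hy t ht
  intro x hx
  set U : Set (E d) := {y | ∀ t ∈ Set.Icc (0 : ℝ) 1, x + t • (y - x) ∈ D}
  have hUD : U ⊆ D := fun y hy => by simpa using hy 1 (by simp)
  have hUo : IsOpen U := by
    refine isOpen_iff_mem_nhds.2 fun y hy => ?_
    have hpre : IsOpen {p : E d × ℝ | x + p.2 • (p.1 - x) ∈ D} :=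
      hD.1.preimage (by fun_prop)
    obtain ⟨u, w, hu, -, hyu, hw, huw⟩ := generalized_tube_lemma (isCompact_singleton (x := y))
      (isCompact_Icc (a := (0 : ℝ)) (b := 1)) hpre (by
        rintro ⟨y', t⟩ ⟨rfl, ht⟩
        exact hy t ht)
    exact Filter.mem_of_superset (hu.mem_nhds (hyu rfl)) fun y' hy' t ht =>
      huw (Set.mk_mem_prod hy' (hw ht))
  refine hD.2.isPreconnected.subset_of_closure_inter_subset hUo
    ⟨x, hx, fun t _ => by simpa using hx⟩ ?_
  rintro y ⟨hyU, hyD⟩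
  refine add_smul_sub_mem_of_mem_closure hD.1 hr hT hx hyD fun t ht => ?_
  exact map_mem_closure (f := fun y => x + t • (y - x)) (by fun_prop) hyU fun y' hy' => hy' t ht

lemma convex_and_isProper_of_iInf_squeezing_pos {D : Set (E d)} (hD : IsDomainSet D)
    (h : 0 < ⨅ z : D, squeezing D z) : Convex ℝ D ∧ IsProper D := by
  set s := ⨅ z : D, squeezing D z
  have hbdd : BddBelow (Set.range fun z : D => squeezing D z) :=
    ⟨0, by rintro _ ⟨z, rfl⟩; exact squeezing_nonneg D z⟩
  have hT : ∀ z ∈ D, ∃ T, Normalizes T D z (s / 2) := fun z hz =>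
    exists_normalizes_of_lt_squeezing (half_pos h).le
      ((half_lt_self h).trans_le (ciInf_le hbdd ⟨z, hz⟩))
  obtain ⟨z, hz⟩ := hD.2.nonempty
  obtain ⟨T, hTz⟩ := hT z hz
  exact ⟨convex_of_forall_normalizes hD (half_pos h) hT, hTz.isProper⟩

lemma le_squeezing_of_convex (hd : 1 ≤ d) {D : Set (E d)} (hD : IsDomainSet D) (hc : Convex ℝ D)
    (hp : IsProper D) {z : E d} (hz : z ∈ D) : (((d : ℝ) + 1) ^ 3)⁻¹ ≤ squeezing D z :=
  le_csSup (bddAbove_squeezingRadii hd D z) <| mem_squeezingRadii_iff.2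
    ⟨by positivity, exists_normalizes_of_convex hD.1 hc hp hz⟩

end ProjSqueeze

theorem theorem1 (d : ℕ) (hd : 1 ≤ d) :
    (∃ r : ℝ, 0 < r ∧
      (∀ D : Set (ProjSqueeze.E d), ProjSqueeze.IsDomainSet D → Convex ℝ D →
        ProjSqueeze.IsProper D → ∀ z ∈ D, r ≤ ProjSqueeze.squeezing D z) ∧
      (∀ D : Set (ProjSqueeze.E d), ProjSqueeze.IsDomainSet D →
        (⨅ z : D, ProjSqueeze.squeezing D z) ∉ Set.Ioo 0 r)) ∧
    (∀ D : Set (ProjSqueeze.E d), ProjSqueeze.IsDomainSet D →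
      0 < (⨅ z : D, ProjSqueeze.squeezing D z) →
      Convex ℝ D ∧ ProjSqueeze.IsProper D) := by
  have hr : (0 : ℝ) < (((d : ℝ) + 1) ^ 3)⁻¹ := by positivity
  refine ⟨⟨_, hr, fun D hD hc hp z hz => ProjSqueeze.le_squeezing_of_convex hd hD hc hp hz,
    fun D hD hmem => ?_⟩, fun D hD h => ProjSqueeze.convex_and_isProper_of_iInf_squeezing_pos hD h⟩
  obtain ⟨hc, hp⟩ := ProjSqueeze.convex_and_isProper_of_iInf_squeezing_pos hD hmem.1
  have : Nonempty D := hD.2.nonempty.to_subtype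
  exact hmem.2.not_ge
    (le_ciInf fun z => ProjSqueeze.le_squeezing_of_convex hd hD hc hp z.2)
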